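/- **Definitions.** A smooth function $g:\mathbb{R}\to\mathbb{R}$ is *analytic at infinity* if there are $\epsilon_1,\epsilon_2>0$ and real sequences $(a_n)_{n\ge1},(b_n)_{n\ge1}$ such that $g(1/x)=\sum_{n\ge1}a_nx^n$ for $0<x<\epsilon_1$ and $g(1/x)=\sum_{n\ge1}b_nx^n$ for $-\epsilon_2<x<0$, both series converging absolutely there. A function $g$ on $\mathbb{R}^d$ ($d=2,3$) is of *decrease $n$* if there is a constant $c>0$ with $|g(v)|\le c/|v|^n$ for all $v$ with $|v|>1$, where $|v|$ is the Euclidean norm. A smooth function $g:\mathbb{R}^2\to\mathbb{R}$ is *normal* if (i) for every $x$, $y\mapsto g(x,y)$ is analytic at infinity; (ii) for every $y$, $x\mapsto g(x,y)$ is analytic at infinity; (iii) $g$ is of decrease $1$; (iv) $\partial g/\partial x$ and $\partial g/\partial y$ are of decrease $2$; (v) there is a number $N$ such that for every $x$ the function $y\mapsto g(x,y)$ and its first two derivatives each have at most $N$ zeros, and for every $y$ the same holds for $x\mapsto g(x,y)$. A smooth function $f:\mathbb{R}^3\to\mathbb{R}$ is *normal* if (i)–(iii) each function on $\mathbb{R}^2$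 obtained from $f$ by fixing one of the three variables at any real value is normal; (iv) $f$ is of decrease $1$; (v) for all $i,j,k\ge0$ with $i+j+k\ge1$, $\partial^{i+j+k}f/\partial x^i\partial y^j\partial z^k$ is of decrease $i+j+k+1$; (vi) there is a number $N$ such that every function on $\mathbb{R}$ obtained from $f$ by fixing two of the three variables at any real values, and each of its first four derivatives, has at most $N$ zeros. **Lemma.** Let $f:\mathbb{R}^3\to\mathbb{R}$ be normal and let $k_1,k_2,k_3$ be nonzero real numbers. Then, for all real $x,y,z$, the limits $$A(k_1,y,z)=\lim_{r\to\infty}\int_{-r}^{r}f(x,y,z)e^{-ik_1x}\,dx,\quad B(x,k_2,z)=\lim_{r\to\infty}\int_{-r}^{r}f(x,y,z)e^{-ik_2y}\,dy,\quad C(x,y,k_3)=\lim_{r\to\infty}\int_{-r}^{r}f(x,y,z)e^{-ik_3z}\,dz,$$ $$F(k_1,k_2,z)=\lim_{r,s\to\infty}\int_{-s}^{s}\int_{-r}^{r}f(x,y,z)e^{-ik_1x}e^{-ik_2y}\,dx\,dy,$$ $$G(k_1,y,k_3)=\lim_{r,s\to\infty}\int_{-s}^{s}\int_{-r}^{r}f(x,y,z)e^{-ik_1x}e^{-ik_3z}\,dx\,dz,$$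 $$H(x,k_2,k_3)=\lim_{r,s\to\infty}\int_{-s}^{s}\int_{-r}^{r}f(x,y,z)e^{-ik_2y}e^{-ik_3z}\,dy\,dz$$ exist (where $r,s\to\infty$ independently), and the integrals $$A(k_1,k_2,k_3)=\int_{-\infty}^{\infty}\int_{-\infty}^{\infty}A(k_1,y,z)e^{-ik_2y}e^{-ik_3z}\,dy\,dz,$$ $$B(k_1,k_2,k_3)=\int_{-\infty}^{\infty}\int_{-\infty}^{\infty}B(x,k_2,z)e^{-ik_1x}e^{-ik_3z}\,dx\,dz,$$ $$C(k_1,k_2,k_3)=\int_{-\infty}^{\infty}\int_{-\infty}^{\infty}C(x,y,k_3)e^{-ik_1x}e^{-ik_2y}\,dx\,dy,$$ $$F(k_1,k_2,k_3)=\int_{-\infty}^{\infty}F(k_1,k_2,z)e^{-ik_3z}\,dz,\quad G(k_1,k_2,k_3)=\int_{-\infty}^{\infty}G(k_1,y,k_3)e^{-ik_2y}\,dy,\quad H(k_1,k_2,k_3)=\int_{-\infty}^{\infty}H(x,k_2,k_3)e^{-ik_1x}\,dx$$ converge absolutely (the double integrals both jointly over $\mathbb{R}^2$ and, in the inner variable,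 for every value of the outer variable). Moreover, all six are equal, and their common value is $$\lim_{r,s,t\to\infty}\int_{-t}^{t}\int_{-s}^{s}\int_{-r}^{r}f(x,y,z)e^{-ik_1x}e^{-ik_2y}e^{-ik_3z}\,dx\,dy\,dz,$$ where $r,s,t\to\infty$ independently. -/

import Mathlib

open Filter Topology MeasureTheory
open scoped ContDiff

namespace NormalFourier

noncomputable section

/-- A smooth function `g` on the line is analytic at infinity: `g (1/x)` is, for small `x > 0`, an
absolutely convergent power series without constant term, and likewise (with possibly different
coefficients) for small `x < 0`. The coefficient of `x ^ (n + 1)` is `a n`, resp. `b n`. -/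
structure AnalyticAtInfinity (g : ℝ → ℝ) : Prop where
  smooth : ContDiff ℝ ∞ g
  right : ∃ ε > 0, ∃ a : ℕ → ℝ, ∀ x : ℝ, 0 < x → x < ε →
    Summable (fun n : ℕ => |a n * x ^ (n + 1)|) ∧ g (1 / x) = ∑' n : ℕ, a n * x ^ (n + 1)
  left : ∃ ε > 0, ∃ b : ℕ → ℝ, ∀ x : ℝ, -ε < x → x < 0 →
    Summable (fun n : ℕ => |b n * x ^ (n + 1)|) ∧ g (1 / x) = ∑' n : ℕ, b n * x ^ (n + 1)

/-- `|g(x,y)| ≤ C / |(x,y)|ⁿ` for `|(x,y)| > 1`, with the Euclidean norm. For `n = 1` this is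
"very moderate decrease", for `n = 2` "moderate decrease", and for `n ≥ 2` in general
"moderate decrease `n`". -/
def Decrease₂ (n : ℕ) (g : ℝ → ℝ → ℝ) : Prop :=
  ∃ C > 0, ∀ x y : ℝ, 1 < √(x ^ 2 + y ^ 2) → |g x y| ≤ C / √(x ^ 2 + y ^ 2) ^ n

/-- `|g(x,y,z)| ≤ C / |(x,y,z)|ⁿ` for `|(x,y,z)| > 1`, with the Euclidean norm. For `n = 1` this is
"very moderate decrease", for `n = 2` "moderate decrease", and for `n ≥ 2` in general
"moderate decrease `n`". -/
def Decrease₃ (n : ℕ) (g : ℝ → ℝ → ℝ → ℝ) : Prop :=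
  ∃ C > 0, ∀ x y z : ℝ, 1 < √(x ^ 2 + y ^ 2 + z ^ 2) →
    |g x y z| ≤ C / √(x ^ 2 + y ^ 2 + z ^ 2) ^ n

/-- Each of `g, g', …, g⁽ᵐ⁾` has at most `val` zeros on the line. -/
def ZerosBounded (m val : ℕ) (g : ℝ → ℝ) : Prop :=
  ∀ j ≤ m, {t : ℝ | iteratedDeriv j g t = 0}.encard ≤ val

/-- Normal functions on the whole plane. -/
structure Normal₂ (g : ℝ → ℝ → ℝ) : Prop where
  smooth : ContDiff ℝ ∞ (fun p : ℝ × ℝ => g p.1 p.2)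
  fibre_fst : ∀ x, AnalyticAtInfinity (fun y => g x y)
  fibre_snd : ∀ y, AnalyticAtInfinity (fun x => g x y)
  decrease : Decrease₂ 1 g
  decrease_deriv_fst : Decrease₂ 2 (fun x y => deriv (fun x' => g x' y) x)
  decrease_deriv_snd : Decrease₂ 2 (fun x y => deriv (fun y' => g x y') y)
  zeros : ∃ val : ℕ, (∀ x, ZerosBounded 2 val (fun y => g x y)) ∧
    (∀ y, ZerosBounded 2 val (fun x => g x y))

/-- The partial derivative `∂^(i+j+k) f / ∂x^i ∂y^j ∂z^k`. -/
def partialDeriv (i j k : ℕ) (f : ℝ → ℝ → ℝ → ℝ) (x y z : ℝ) : ℝ :=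
  iteratedDeriv i (fun x' => iteratedDeriv j (fun y' => iteratedDeriv k (fun z' =>
    f x' y' z') z) y) x

/-- Normal functions on the whole space. -/
structure Normal₃ (f : ℝ → ℝ → ℝ → ℝ) : Prop where
  smooth : ContDiff ℝ ∞ (fun p : ℝ × ℝ × ℝ => f p.1 p.2.1 p.2.2)
  fibre_x : ∀ x, Normal₂ (fun y z => f x y z)
  fibre_y : ∀ y, Normal₂ (fun x z => f x y z)
  fibre_z : ∀ z, Normal₂ (fun x y => f x y z)
  decrease : Decrease₃ 1 f
  decrease_deriv : ∀ i j k : ℕ, 1 ≤ i + j + k →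
    Decrease₃ (i + j + k + 1) (partialDeriv i j k f)
  zeros : ∃ val : ℕ, (∀ x y, ZerosBounded 4 val (fun z => f x y z)) ∧
    (∀ x z, ZerosBounded 4 val (fun y => f x y z)) ∧
    (∀ y z, ZerosBounded 4 val (fun x => f x y z))

/-- The Fourier kernel `e^{-ikx}`. -/
def e (k x : ℝ) : ℂ := Complex.exp (-(Complex.I * k * x))

/-! Truncated transforms in one, two and three variables. -/

def truncA (f : ℝ → ℝ → ℝ → ℝ) (k₁ y z r : ℝ) : ℂ :=
  ∫ x in -r..r, (f x y z : ℂ) * e k₁ x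

def truncB (f : ℝ → ℝ → ℝ → ℝ) (x k₂ z r : ℝ) : ℂ :=
  ∫ y in -r..r, (f x y z : ℂ) * e k₂ y

def truncC (f : ℝ → ℝ → ℝ → ℝ) (x y k₃ r : ℝ) : ℂ :=
  ∫ z in -r..r, (f x y z : ℂ) * e k₃ z

def truncF (f : ℝ → ℝ → ℝ → ℝ) (k₁ k₂ z : ℝ) (p : ℝ × ℝ) : ℂ :=
  ∫ y in -p.2..p.2, ∫ x in -p.1..p.1, (f x y z : ℂ) * e k₁ x * e k₂ y

def truncG (f : ℝ → ℝ → ℝ → ℝ) (k₁ y k₃ : ℝ) (p : ℝ × ℝ) : ℂ :=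
  ∫ z in -p.2..p.2, ∫ x in -p.1..p.1, (f x y z : ℂ) * e k₁ x * e k₃ z

def truncH (f : ℝ → ℝ → ℝ → ℝ) (x k₂ k₃ : ℝ) (p : ℝ × ℝ) : ℂ :=
  ∫ z in -p.2..p.2, ∫ y in -p.1..p.1, (f x y z : ℂ) * e k₂ y * e k₃ z

/-- The integral over the box `[-r,r] × [-s,s] × [-t,t]`, where `p = (r, s, t)`. -/
def truncBox (f : ℝ → ℝ → ℝ → ℝ) (k₁ k₂ k₃ : ℝ) (p : ℝ × ℝ × ℝ) : ℂ :=
  ∫ z in -p.2.2..p.2.2, ∫ y in -p.2.1..p.2.1, ∫ x in -p.1..p.1,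
    (f x y z : ℂ) * e k₁ x * e k₂ y * e k₃ z

/-! The partial transforms, as limits of the truncated ones. The limit in two parameters is the
joint one: `atTop` on `ℝ × ℝ` means that both parameters tend to infinity independently. -/

def A (f : ℝ → ℝ → ℝ → ℝ) (k₁ y z : ℝ) : ℂ := limUnder atTop (truncA f k₁ y z)

def B (f : ℝ → ℝ → ℝ → ℝ) (x k₂ z : ℝ) : ℂ := limUnder atTop (truncB f x k₂ z)

def C (f : ℝ → ℝ → ℝ → ℝ) (x y k₃ : ℝ) : ℂ := limUnder atTop (truncC f x y k₃)

def F (f : ℝ → ℝ → ℝ → ℝ) (k₁ k₂ z : ℝ) : ℂ := limUnder atTop (truncF f k₁ k₂ z)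

def G (f : ℝ → ℝ → ℝ → ℝ) (k₁ y k₃ : ℝ) : ℂ := limUnder atTop (truncG f k₁ y k₃)

def H (f : ℝ → ℝ → ℝ → ℝ) (x k₂ k₃ : ℝ) : ℂ := limUnder atTop (truncH f x k₂ k₃)

/-! The six full transforms, obtained by integrating out the remaining variables. -/

def hatA (f : ℝ → ℝ → ℝ → ℝ) (k₁ k₂ k₃ : ℝ) : ℂ := ∫ z, ∫ y, A f k₁ y z * e k₂ y * e k₃ z

def hatB (f : ℝ → ℝ → ℝ → ℝ) (k₁ k₂ k₃ : ℝ) : ℂ := ∫ z, ∫ x, B f x k₂ z * e k₁ x * e k₃ z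

def hatC (f : ℝ → ℝ → ℝ → ℝ) (k₁ k₂ k₃ : ℝ) : ℂ := ∫ y, ∫ x, C f x y k₃ * e k₁ x * e k₂ y

def hatF (f : ℝ → ℝ → ℝ → ℝ) (k₁ k₂ k₃ : ℝ) : ℂ := ∫ z, F f k₁ k₂ z * e k₃ z

def hatG (f : ℝ → ℝ → ℝ → ℝ) (k₁ k₂ k₃ : ℝ) : ℂ := ∫ y, G f k₁ y k₃ * e k₂ y

def hatH (f : ℝ → ℝ → ℝ → ℝ) (k₁ k₂ k₃ : ℝ) : ℂ := ∫ x, H f x k₂ k₃ * e k₁ x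

/-- All six partial transforms exist as limits, for all values of the free variables. -/
structure PartialTransformsExist (f : ℝ → ℝ → ℝ → ℝ) (k₁ k₂ k₃ : ℝ) : Prop where
  exists_A : ∀ y z, Tendsto (truncA f k₁ y z) atTop (𝓝 (A f k₁ y z))
  exists_B : ∀ x z, Tendsto (truncB f x k₂ z) atTop (𝓝 (B f x k₂ z))
  exists_C : ∀ x y, Tendsto (truncC f x y k₃) atTop (𝓝 (C f x y k₃))
  exists_F : ∀ z, Tendsto (truncF f k₁ k₂ z) atTop (𝓝 (F f k₁ k₂ z))
  exists_G : ∀ y, Tendsto (truncG f k₁ y k₃) atTop (𝓝 (G f k₁ y k₃))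
  exists_H : ∀ x, Tendsto (truncH f x k₂ k₃) atTop (𝓝 (H f x k₂ k₃))

/-- All integrals in the six full transforms converge absolutely: the double ones jointly (over the
plane) and also in the inner variable for every value of the outer one. -/
structure FullTransformsDefined (f : ℝ → ℝ → ℝ → ℝ) (k₁ k₂ k₃ : ℝ) : Prop where
  integrable_A : Integrable (fun p : ℝ × ℝ => A f k₁ p.1 p.2 * e k₂ p.1 * e k₃ p.2)
  integrable_A_inner : ∀ z, Integrable (fun y => A f k₁ y z * e k₂ y * e k₃ z)
  integrable_B : Integrable (fun p : ℝ × ℝ => B f p.1 k₂ p.2 * e k₁ p.1 * e k₃ p.2)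
  integrable_B_inner : ∀ z, Integrable (fun x => B f x k₂ z * e k₁ x * e k₃ z)
  integrable_C : Integrable (fun p : ℝ × ℝ => C f p.1 p.2 k₃ * e k₁ p.1 * e k₂ p.2)
  integrable_C_inner : ∀ y, Integrable (fun x => C f x y k₃ * e k₁ x * e k₂ y)
  integrable_F : Integrable (fun z => F f k₁ k₂ z * e k₃ z)
  integrable_G : Integrable (fun y => G f k₁ y k₃ * e k₂ y)
  integrable_H : Integrable (fun x => H f x k₂ k₃ * e k₁ x)

end

end NormalFourier

namespace NormalFourier

noncomputable section

/-- Smooth real functions on three-space. -/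
abbrev SmoothFun : Type := {g : ℝ × ℝ × ℝ → ℝ // ContDiff ℝ ∞ g}

/-- The derivative of a smooth function in the fixed direction `v`. -/
def dirDeriv (v : ℝ × ℝ × ℝ) (g : SmoothFun) : SmoothFun :=
  ⟨fun p => fderiv ℝ g.1 p v,
    (g.2.fderiv_right (m := ∞) (by simp)).clm_apply contDiff_const⟩

lemma dirDeriv_commute (v w : ℝ × ℝ × ℝ) : Function.Commute (dirDeriv v) (dirDeriv w) := by
  intro g
  apply Subtype.ext
  funext p
  have hd : ∀ q, DifferentiableAt ℝ (fderiv ℝ g.1) q := fun q =>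
    ((g.2.fderiv_right (m := ∞) (by simp)).differentiable (by simp)).differentiableAt
  have key : ∀ a b : ℝ × ℝ × ℝ,
      (dirDeriv a (dirDeriv b g)).1 p = fderiv ℝ (fderiv ℝ g.1) p a b := by
    intro a b
    have h := (hd p).hasFDerivAt.clm_apply (hasFDerivAt_const b p)
    change fderiv ℝ (fun q => fderiv ℝ g.1 q b) p a = _
    rw [h.fderiv]
    simp
  rw [key, key]
  exact (g.2.contDiffAt.isSymmSndFDerivAt 
    (by simpa using WithTop.coe_le_coe.2 (le_top : (2 : ℕ∞) ≤ ⊤))) v w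

lemma SmoothFun.differentiableAt (g : SmoothFun) (p : ℝ × ℝ × ℝ) : DifferentiableAt ℝ g.1 p :=
  (g.2.differentiable (by simp)).differentiableAt

lemma hasDerivAt_fst (g : SmoothFun) (x y z : ℝ) :
    HasDerivAt (fun t => g.1 (t, y, z)) ((dirDeriv (1, 0, 0) g).1 (x, y, z)) x :=
  (g.differentiableAt (x, y, z)).hasFDerivAt.comp_hasDerivAt x
    ((hasDerivAt_id x).prodMk ((hasDerivAt_const x y).prodMk (hasDerivAt_const x z)))

lemma hasDerivAt_snd (g : SmoothFun) (x y z : ℝ) :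
    HasDerivAt (fun t => g.1 (x, t, z)) ((dirDeriv (0, 1, 0) g).1 (x, y, z)) y :=
  (g.differentiableAt (x, y, z)).hasFDerivAt.comp_hasDerivAt y
    ((hasDerivAt_const y x).prodMk ((hasDerivAt_id y).prodMk (hasDerivAt_const y z)))

lemma hasDerivAt_thd (g : SmoothFun) (x y z : ℝ) :
    HasDerivAt (fun t => g.1 (x, y, t)) ((dirDeriv (0, 0, 1) g).1 (x, y, z)) z :=
  (g.differentiableAt (x, y, z)).hasFDerivAt.comp_hasDerivAt z
    ((hasDerivAt_const z x).prodMk ((hasDerivAt_const z y).prodMk (hasDerivAt_id z)))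

lemma iteratedDeriv_fst (g : SmoothFun) (n : ℕ) (y z : ℝ) :
    iteratedDeriv n (fun t => g.1 (t, y, z)) =
      fun x => ((dirDeriv (1, 0, 0))^[n] g).1 (x, y, z) := by
  induction n with
  | zero => simp
  | succ n ih =>
    rw [iteratedDeriv_succ, ih]
    funext x
    rw [Function.iterate_succ_apply']
    exact (hasDerivAt_fst _ x y z).deriv

lemma iteratedDeriv_snd (g : SmoothFun) (n : ℕ) (x z : ℝ) :
    iteratedDeriv n (fun t => g.1 (x, t, z)) =
      fun y => ((dirDeriv (0, 1, 0))^[n] g).1 (x, y, z) := by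
  induction n with
  | zero => simp
  | succ n ih =>
    rw [iteratedDeriv_succ, ih]
    funext y
    rw [Function.iterate_succ_apply']
    exact (hasDerivAt_snd _ x y z).deriv

lemma iteratedDeriv_thd (g : SmoothFun) (n : ℕ) (x y : ℝ) :
    iteratedDeriv n (fun t => g.1 (x, y, t)) =
      fun z => ((dirDeriv (0, 0, 1))^[n] g).1 (x, y, z) := by
  induction n with
  | zero => simp
  | succ n ih =>
    rw [iteratedDeriv_succ, ih]
    funext z
    rw [Function.iterate_succ_apply']
    exact (hasDerivAt_thd _ x y z).deriv

/-- The mixed partial derivatives of a smooth function, as smooth functions. -/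
def mixedDeriv (i j k : ℕ) (g : SmoothFun) : SmoothFun :=
  (dirDeriv (1, 0, 0))^[i] ((dirDeriv (0, 1, 0))^[j] ((dirDeriv (0, 0, 1))^[k] g))

lemma partialDeriv_eq_mixedDeriv {f : ℝ → ℝ → ℝ → ℝ}
    (hf : ContDiff ℝ ∞ (fun p : ℝ × ℝ × ℝ => f p.1 p.2.1 p.2.2)) (i j k : ℕ) (x y z : ℝ) :
    partialDeriv i j k f x y z = (mixedDeriv i j k ⟨_, hf⟩).1 (x, y, z) := by
  set g : SmoothFun := ⟨_, hf⟩ with hg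
  have h1 : ∀ x' y', iteratedDeriv k (fun z' => f x' y' z') z =
      ((dirDeriv (0, 0, 1))^[k] g).1 (x', y', z) := fun x' y' =>
    congrFun (iteratedDeriv_thd g k x' y') z
  unfold partialDeriv mixedDeriv
  simp only [h1, iteratedDeriv_snd, iteratedDeriv_fst]

lemma dirDeriv_fst_mixedDeriv (i j k : ℕ) (g : SmoothFun) :
    dirDeriv (1, 0, 0) (mixedDeriv i j k g) = mixedDeriv (i + 1) j k g :=
  (Function.iterate_succ_apply' _ _ _).symm

lemma dirDeriv_snd_mixedDeriv (i j k : ℕ) (g : SmoothFun) :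
    dirDeriv (0, 1, 0) (mixedDeriv i j k g) = mixedDeriv i (j + 1) k g := by
  unfold mixedDeriv
  rw [((dirDeriv_commute _ _).iterate_right i).eq, Function.iterate_succ_apply']

lemma dirDeriv_thd_mixedDeriv (i j k : ℕ) (g : SmoothFun) :
    dirDeriv (0, 0, 1) (mixedDeriv i j k g) = mixedDeriv i j (k + 1) g := by
  unfold mixedDeriv
  rw [((dirDeriv_commute _ _).iterate_right i).eq, ((dirDeriv_commute _ _).iterate_right j).eq,
    Function.iterate_succ_apply']

/-- A continuous function of decrease `n` is bounded everywhere by a multiple of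
`(1 + |v|²) ^ (-n/2)`. -/
lemma Decrease₃.exists_bound {n : ℕ} {g : ℝ → ℝ → ℝ → ℝ} (h : Decrease₃ n g)
    (hc : Continuous (fun p : ℝ × ℝ × ℝ => g p.1 p.2.1 p.2.2)) :
    ∃ C, 0 ≤ C ∧ ∀ x y z,
      |g x y z| ≤ C * (1 + x ^ 2 + y ^ 2 + z ^ 2) ^ (-(n : ℝ) / 2) := by
  obtain ⟨c, hc0, hcb⟩ := h
  obtain ⟨M, hM⟩ := ((isCompact_Icc (a := (-1 : ℝ)) (b := 1)).prod
    ((isCompact_Icc (a := (-1 : ℝ)) (b := 1)).prod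
      (isCompact_Icc (a := (-1 : ℝ)) (b := 1)))).exists_bound_of_continuousOn hc.continuousOn
  have hM0 : 0 ≤ M := (norm_nonneg _).trans (hM (0, 0, 0) (by simp))
  refine ⟨(M + c) * 2 ^ n, by positivity, fun x y z => ?_⟩
  set Q := x ^ 2 + y ^ 2 + z ^ 2 with hQ
  have hQ0 : 0 ≤ Q := by positivity
  have e1 : (1 + x ^ 2 + y ^ 2 + z ^ 2) ^ (-(n : ℝ) / 2) = (√(1 + Q) ^ n)⁻¹ := by
    rw [neg_div, Real.rpow_neg (by positivity), Real.rpow_div_two_eq_sqrt _ (by positivity),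
      Real.rpow_natCast, hQ]
    ring_nf
  rw [e1, ← div_eq_mul_inv, le_div_iff₀ (by positivity)]
  rcases lt_or_ge 1 (√Q) with h1 | h1
  · have hs : √(1 + Q) ≤ √Q * 2 := by
      rw [Real.sqrt_le_left (by positivity), mul_pow, Real.sq_sqrt hQ0]
      nlinarith [Real.sq_sqrt hQ0]
    calc |g x y z| * √(1 + Q) ^ n ≤ c / √Q ^ n * (√Q * 2) ^ n := by
          gcongr
          exact hcb x y z h1
      _ = c * 2 ^ n := by
          rw [mul_pow]
          field_simp
      _ ≤ (M + c) * 2 ^ n := by gcongr; linarith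
  · have hQ1 : Q ≤ 1 := by simpa using h1
    have hs : √(1 + Q) ≤ 2 := by
      rw [Real.sqrt_le_left (by positivity)]
      linarith
    have hg : |g x y z| ≤ M := by
      refine hM (x, y, z) ⟨?_, ?_, ?_⟩ <;>
      · rw [Set.mem_Icc, ← abs_le, ← sq_le_one_iff_abs_le_one]
        nlinarith [sq_nonneg x, sq_nonneg y, sq_nonneg z]
    calc |g x y z| * √(1 + Q) ^ n ≤ (M + c) * 2 ^ n := by
          gcongr
          linarith

/-- `D i j k` is the family of partial derivatives of `f`, and the derivatives of order `n` decay
like `|v| ^ (-(n + 1))`. The notion is symmetric in the three variables. -/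
structure DecayTower (f : ℝ → ℝ → ℝ → ℝ) (D : ℕ → ℕ → ℕ → ℝ → ℝ → ℝ → ℂ) : Prop where
  zero : ∀ x y z, D 0 0 0 x y z = f x y z
  cont : ∀ i j k, Continuous (fun p : ℝ × ℝ × ℝ => D i j k p.1 p.2.1 p.2.2)
  deriv_fst : ∀ i j k x y z, HasDerivAt (fun t => D i j k t y z) (D (i + 1) j k x y z) x
  deriv_snd : ∀ i j k x y z, HasDerivAt (fun t => D i j k x t z) (D i (j + 1) k x y z) y
  deriv_thd : ∀ i j k x y z, HasDerivAt (fun t => D i j k x y t) (D i j (k + 1) x y z) z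
  bound : ∀ i j k, ∃ C, 0 ≤ C ∧ ∀ x y z,
    ‖D i j k x y z‖ ≤ C * (1 + x ^ 2 + y ^ 2 + z ^ 2) ^ (-((i + j + k + 1 : ℕ) : ℝ) / 2)

lemma Normal₃.exists_decayTower {f : ℝ → ℝ → ℝ → ℝ} (hf : Normal₃ f) :
    ∃ D, DecayTower f D := by
  set g : SmoothFun := ⟨_, hf.smooth⟩ with hg
  refine ⟨fun i j k x y z => ((mixedDeriv i j k g).1 (x, y, z) : ℂ), ?_, ?_, ?_, ?_, ?_, ?_⟩
  · intro x y z
    rfl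
  · intro i j k
    exact Complex.continuous_ofReal.comp (mixedDeriv i j k g).2.continuous
  · intro i j k x y z
    rw [← dirDeriv_fst_mixedDeriv]
    exact (hasDerivAt_fst (mixedDeriv i j k g) x y z).ofReal_comp
  · intro i j k x y z
    rw [← dirDeriv_snd_mixedDeriv]
    exact (hasDerivAt_snd (mixedDeriv i j k g) x y z).ofReal_comp
  · intro i j k x y z
    rw [← dirDeriv_thd_mixedDeriv]
    exact (hasDerivAt_thd (mixedDeriv i j k g) x y z).ofReal_comp
  · intro i j k
    have hdec : Decrease₃ (i + j + k + 1) (fun x y z => (mixedDeriv i j k g).1 (x, y, z)) := by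
      rcases Nat.eq_zero_or_pos (i + j + k) with h | h
      · obtain ⟨rfl, rfl, rfl⟩ : i = 0 ∧ j = 0 ∧ k = 0 := by omega
        exact hf.decrease
      · have := hf.decrease_deriv i j k h
        have he : partialDeriv i j k f = fun x y z => (mixedDeriv i j k g).1 (x, y, z) := by
          funext x y z
          exact partialDeriv_eq_mixedDeriv hf.smooth i j k x y z
        rwa [he] at this
    obtain ⟨C, hC, hb⟩ := hdec.exists_bound (mixedDeriv i j k g).2.continuous
    refine ⟨C, hC, fun x y z => ?_⟩
    rw [Complex.norm_real]
    exact hb x y z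

/-- Exchanging the first two variables. -/
lemma DecayTower.swap_fst {f : ℝ → ℝ → ℝ → ℝ} {D : ℕ → ℕ → ℕ → ℝ → ℝ → ℝ → ℂ}
    (h : DecayTower f D) :
    DecayTower (fun y x z => f x y z) (fun j i k y x z => D i j k x y z) where
  zero y x z := h.zero x y z
  cont j i k := (h.cont i j k).comp (by fun_prop : Continuous
    (fun p : ℝ × ℝ × ℝ => (p.2.1, p.1, p.2.2)))
  deriv_fst j i k y x z := h.deriv_snd i j k x y z
  deriv_snd j i k y x z := h.deriv_fst i j k x y z
  deriv_thd j i k y x z := h.deriv_thd i j k x y z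
  bound j i k := by
    obtain ⟨C, hC, hb⟩ := h.bound i j k
    refine ⟨C, hC, fun y x z => ?_⟩
    have := hb x y z
    rwa [add_comm i j, add_right_comm 1 (x ^ 2)] at this

/-- Exchanging the last two variables. -/
lemma DecayTower.swap_snd {f : ℝ → ℝ → ℝ → ℝ} {D : ℕ → ℕ → ℕ → ℝ → ℝ → ℝ → ℂ}
    (h : DecayTower f D) :
    DecayTower (fun x z y => f x y z) (fun i k j x z y => D i j k x y z) where
  zero x z y := h.zero x y z
  cont i k j := (h.cont i j k).comp (by fun_prop : Continuous
    (fun p : ℝ × ℝ × ℝ => (p.1, p.2.2, p.2.1)))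
  deriv_fst i k j x z y := h.deriv_fst i j k x y z
  deriv_snd i k j x z y := h.deriv_thd i j k x y z
  deriv_thd i k j x z y := h.deriv_snd i j k x y z
  bound i k j := by
    obtain ⟨C, hC, hb⟩ := h.bound i j k
    refine ⟨C, hC, fun x z y => ?_⟩
    have := hb x y z
    rwa [add_right_comm i j k, add_right_comm (1 + x ^ 2)] at this

/-! ### Weights -/

/-- The weight `(1 + u²) ^ (-a)`. -/
def weight (a u : ℝ) : ℝ := (1 + u ^ 2) ^ (-a)

lemma weight_nonneg (a u : ℝ) : 0 ≤ weight a u := by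
  unfold weight
  positivity

lemma integrable_weight {a : ℝ} (ha : 1 / 2 < a) : Integrable (weight a) := by
  have h := integrable_rpow_neg_one_add_norm_sq (E := ℝ) (μ := volume) (r := 2 * a)
    (by simp; linarith)
  refine h.congr (Eventually.of_forall fun u => ?_)
  simp only [weight, Real.norm_eq_abs, sq_abs]
  congr 1
  ring

lemma weight_neg (a u : ℝ) : weight a (-u) = weight a u := by
  simp [weight]

lemma tendsto_weight {a : ℝ} (ha : 0 < a) : Tendsto (weight a) atTop (𝓝 0) :=
  (tendsto_rpow_neg_atTop ha).comp
    (tendsto_atTop_add_const_left _ _ (tendsto_pow_atTop two_ne_zero))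

lemma rpow_le_weight_mul {a b c d : ℝ} (ha : 0 ≤ a) (hb : 0 ≤ b) (hc : 0 ≤ c)
    (hd : a + b + c ≤ d) (x y z : ℝ) :
    (1 + x ^ 2 + y ^ 2 + z ^ 2) ^ (-d) ≤ weight a x * (weight b y * weight c z) := by
  have hQ : 1 ≤ 1 + x ^ 2 + y ^ 2 + z ^ 2 := by nlinarith [sq_nonneg x, sq_nonneg y, sq_nonneg z]
  have hQ0 : 0 < 1 + x ^ 2 + y ^ 2 + z ^ 2 := by linarith
  calc (1 + x ^ 2 + y ^ 2 + z ^ 2) ^ (-d)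
      ≤ (1 + x ^ 2 + y ^ 2 + z ^ 2) ^ (-a + (-b + -c)) :=
        Real.rpow_le_rpow_of_exponent_le hQ (by linarith)
    _ = (1 + x ^ 2 + y ^ 2 + z ^ 2) ^ (-a) * ((1 + x ^ 2 + y ^ 2 + z ^ 2) ^ (-b) *
        (1 + x ^ 2 + y ^ 2 + z ^ 2) ^ (-c)) := by
        rw [Real.rpow_add hQ0, Real.rpow_add hQ0]
    _ ≤ weight a x * (weight b y * weight c z) := by
        have key : ∀ {p t : ℝ}, 0 ≤ p → t ^ 2 ≤ x ^ 2 + y ^ 2 + z ^ 2 →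
            (1 + x ^ 2 + y ^ 2 + z ^ 2) ^ (-p) ≤ weight p t := fun hp ht =>
          Real.rpow_le_rpow_of_nonpos (by positivity) (by linarith) (by linarith)
        have := weight_nonneg a x
        have := weight_nonneg b y
        gcongr
        · exact key ha (by nlinarith [sq_nonneg y, sq_nonneg z])
        · exact key hb (by nlinarith [sq_nonneg x, sq_nonneg z])
        · exact key hc (by nlinarith [sq_nonneg x, sq_nonneg y])

lemma DecayTower.norm_le_weight {f : ℝ → ℝ → ℝ → ℝ} {D : ℕ → ℕ → ℕ → ℝ → ℝ → ℝ → ℂ}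
    (h : DecayTower f D) (i j k : ℕ) {a b c : ℝ} (ha : 0 ≤ a) (hb : 0 ≤ b) (hc : 0 ≤ c)
    (hd : a + b + c ≤ ((i + j + k + 1 : ℕ) : ℝ) / 2) :
    ∃ K, 0 ≤ K ∧ ∀ x y z, ‖D i j k x y z‖ ≤ K * (weight a x * (weight b y * weight c z)) := by
  obtain ⟨K, hK, hbd⟩ := h.bound i j k
  refine ⟨K, hK, fun x y z => (hbd x y z).trans ?_⟩
  rw [neg_div]
  exact mul_le_mul_of_nonneg_left (rpow_le_weight_mul ha hb hc hd x y z) hK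

/-! ### Truncated oscillatory integrals -/

lemma norm_e (k x : ℝ) : ‖e k x‖ = 1 := by
  have : e k x = Complex.exp (((-(k * x) : ℝ) : ℂ) * Complex.I) := by
    unfold e
    congr 1
    push_cast
    ring
  rw [this, Complex.norm_exp_ofReal_mul_I]

@[fun_prop]
lemma continuous_e (k : ℝ) : Continuous (e k) := by
  unfold e
  fun_prop

lemma hasDerivAt_e (k x : ℝ) : HasDerivAt (e k) (-(Complex.I * k) * e k x) x := by
  have h : HasDerivAt (fun t : ℝ => -(Complex.I * k * (t : ℂ))) (-(Complex.I * k)) x := by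
    have h0 := ((Complex.ofRealCLM.hasDerivAt (x := x)).const_mul (Complex.I * k)).fun_neg
    simpa using h0
  have h1 : HasDerivAt (e k) (e k x * -(Complex.I * k)) x := h.cexp
  rwa [mul_comm (e k x)] at h1

lemma I_mul_ne_zero {k : ℝ} (hk : k ≠ 0) : Complex.I * (k : ℂ) ≠ 0 :=
  mul_ne_zero Complex.I_ne_zero (by exact_mod_cast hk)

lemma integral_mul_e_by_parts {k : ℝ} (hk : k ≠ 0) {g g' : ℝ → ℂ}
    (hg : ∀ x, HasDerivAt g (g' x) x) (hg' : Continuous g') (a b : ℝ) :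
    ∫ x in a..b, g x * e k x =
      (Complex.I * k)⁻¹ * (g a * e k a - g b * e k b + ∫ x in a..b, g' x * e k x) := by
  have hgc : Continuous g := continuous_iff_continuousAt.2 fun x => (hg x).continuousAt
  have hv' : Continuous (fun x => -(Complex.I * k) * e k x) := by fun_prop
  have h := intervalIntegral.integral_mul_deriv_eq_deriv_mul (a := a) (b := b)
    (fun x _ => hg x) (fun x _ => hasDerivAt_e k x) (hg'.intervalIntegrable _ _)
    (hv'.intervalIntegrable _ _)
  have h2 : ∫ x in a..b, g x * (-(Complex.I * k) * e k x) =
      -(Complex.I * k) * ∫ x in a..b, g x * e k x := by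
    rw [← intervalIntegral.integral_const_mul]
    congr 1
    funext x
    ring
  rw [h2] at h
  rw [eq_inv_mul_iff_mul_eq₀ (I_mul_ne_zero hk)]
  linear_combination -h

lemma norm_integral_le_integral_bound {g : ℝ → ℂ} {b : ℝ → ℝ} (hb : Integrable b)
    (hg : ∀ x, ‖g x‖ ≤ b x) (u v : ℝ) : ‖∫ x in u..v, g x‖ ≤ ∫ x, b x := by
  have hb0 : 0 ≤ b := fun x => (norm_nonneg _).trans (hg x)
  refine (intervalIntegral.norm_integral_le_abs_of_norm_le (Eventually.of_forall hg)
    hb.intervalIntegrable).trans ?_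
  rw [intervalIntegral.abs_intervalIntegral_eq, abs_of_nonneg (integral_nonneg hb0)]
  exact setIntegral_le_integral hb (Eventually.of_forall hb0)

/-- A dominated convergence theorem for integrals over growing symmetric intervals. -/
lemma tendsto_integral_symm_interval {ι : Type*} {l : Filter ι} [l.IsCountablyGenerated]
    {h : ι → ℝ → ℂ} {h₀ : ℝ → ℂ} {s : ι → ℝ} {b : ℝ → ℝ} (hb : Integrable b)
    (hc : ∀ i, Continuous (h i)) (hbd : ∀ i y, ‖h i y‖ ≤ b y) (hs : Tendsto s l atTop)
    (hlim : ∀ y, Tendsto (fun i => h i y) l (𝓝 (h₀ y))) :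
    Tendsto (fun i => ∫ y in -(s i)..s i, h i y) l (𝓝 (∫ y, h₀ y)) := by
  have key : Tendsto (fun i => ∫ y, (Set.Ioc (-(s i)) (s i)).indicator (h i) y) l
      (𝓝 (∫ y, h₀ y)) := by
    refine tendsto_integral_filter_of_dominated_convergence b ?_ ?_ hb ?_
    · exact Eventually.of_forall fun i =>
        ((hc i).stronglyMeasurable.indicator measurableSet_Ioc).aestronglyMeasurable
    · exact Eventually.of_forall fun i => Eventually.of_forall fun y =>
        (norm_indicator_le_norm_self _ _).trans (hbd i y)
    · refine Eventually.of_forall fun y => (hlim y).congr' ?_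
      filter_upwards [hs.eventually_gt_atTop |y|] with i hi
      rw [Set.indicator_of_mem]
      exact ⟨by linarith [neg_abs_le y], by linarith [le_abs_self y]⟩
  refine key.congr' ?_
  filter_upwards [hs.eventually_ge_atTop 0] with i hi
  rw [integral_indicator measurableSet_Ioc, intervalIntegral.integral_of_le (by linarith)]

/-- The constant in the bound for truncated oscillatory integrals. -/
def oscConst (k : ℝ) : ℝ := ‖(Complex.I * (k : ℂ))⁻¹‖ * (2 + ∫ u, weight (5 / 8) u)

lemma norm_integral_mul_e_le {k : ℝ} (hk : k ≠ 0) {g g' : ℝ → ℂ} {M : ℝ}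
    (hg : ∀ x, HasDerivAt g (g' x) x) (hg' : Continuous g') (hM : ∀ x, ‖g x‖ ≤ M)
    (hM' : ∀ x, ‖g' x‖ ≤ M * weight (5 / 8) x) (a b : ℝ) :
    ‖∫ x in a..b, g x * e k x‖ ≤ oscConst k * M := by
  rw [integral_mul_e_by_parts hk hg hg', norm_mul, oscConst, mul_assoc]
  refine mul_le_mul_of_nonneg_left ?_ (norm_nonneg _)
  have h1 : ‖∫ x in a..b, g' x * e k x‖ ≤ M * ∫ u, weight (5 / 8) u := by
    rw [← integral_const_mul]
    refine norm_integral_le_integral_bound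
      ((integrable_weight (by norm_num)).const_mul M) (fun x => ?_) a b
    rw [norm_mul, norm_e, mul_one]
    exact hM' x
  have h2 : ∀ x, ‖g x * e k x‖ ≤ M := fun x => by
    rw [norm_mul, norm_e, mul_one]
    exact hM x
  calc ‖g a * e k a - g b * e k b + ∫ x in a..b, g' x * e k x‖
      ≤ ‖g a * e k a‖ + ‖g b * e k b‖ + ‖∫ x in a..b, g' x * e k x‖ :=
        (norm_add_le _ _).trans (by gcongr; exact norm_sub_le _ _)
    _ ≤ M + M + M * ∫ u, weight (5 / 8) u := by gcongr <;> apply_assumption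
    _ = (2 + ∫ u, weight (5 / 8) u) * M := by ring

lemma intervalIntegral_swap_of_continuous {φ : ℝ → ℝ → ℂ} (hφ : Continuous φ.uncurry)
    (a b c d : ℝ) : ∫ y in a..b, ∫ x in c..d, φ y x = ∫ x in c..d, ∫ y in a..b, φ y x := by
  refine intervalIntegral_intervalIntegral_swap ?_
  refine (hφ.continuousOn.integrableOn_compact
    ((isCompact_uIcc (a := a) (b := b)).prod (isCompact_uIcc (a := c) (b := d)))).mono_set ?_
  exact Set.prod_mono Set.uIoc_subset_uIcc Set.uIoc_subset_uIcc

lemma integral_integral_mul_e_by_parts {k : ℝ} (hk : k ≠ 0) (l : ℝ) {g g' : ℝ → ℝ → ℂ}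
    (hg : ∀ x y, HasDerivAt (fun t => g t y) (g' x y) x) (hgc : Continuous g.uncurry)
    (hg' : Continuous g'.uncurry) (a b c d : ℝ) :
    ∫ y in c..d, ∫ x in a..b, g x y * e k x * e l y =
      (Complex.I * k)⁻¹ * (e k a * (∫ y in c..d, g a y * e l y) -
        e k b * (∫ y in c..d, g b y * e l y) +
        ∫ y in c..d, ∫ x in a..b, g' x y * e k x * e l y) := by
  have inner : ∀ y, ∫ x in a..b, g x y * e k x * e l y =
      (Complex.I * k)⁻¹ * (e k a * (g a y * e l y) - e k b * (g b y * e l y) +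
        ∫ x in a..b, g' x y * e k x * e l y) := by
    intro y
    rw [intervalIntegral.integral_mul_const, intervalIntegral.integral_mul_const,
      integral_mul_e_by_parts hk (fun x => hg x y) (by fun_prop)]
    ring
  have c1 : ∀ t, Continuous fun y => e k t * (g t y * e l y) := by fun_prop
  have c2 : Continuous fun y => ∫ x in a..b, g' x y * e k x * e l y := by fun_prop
  simp_rw [inner]
  rw [intervalIntegral.integral_const_mul, intervalIntegral.integral_add
    (((c1 a).fun_sub (c1 b)).intervalIntegrable _ _) (c2.intervalIntegrable _ _),
    intervalIntegral.integral_sub ((c1 a).intervalIntegrable _ _) ((c1 b).intervalIntegrable _ _),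
    intervalIntegral.integral_const_mul, intervalIntegral.integral_const_mul]

lemma norm_integral_integral_mul_e_le {k l : ℝ} (hk : k ≠ 0) (hl : l ≠ 0)
    {g gx gy gxy : ℝ → ℝ → ℂ} {M : ℝ}
    (hgx : ∀ x y, HasDerivAt (fun t => g t y) (gx x y) x)
    (hgy : ∀ x y, HasDerivAt (fun t => g x t) (gy x y) y)
    (hgxy : ∀ x y, HasDerivAt (fun t => gx x t) (gxy x y) y)
    (cg : Continuous g.uncurry) (cgx : Continuous gx.uncurry) (cgy : Continuous gy.uncurry)
    (cgxy : Continuous gxy.uncurry)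
    (hM : ∀ x y, ‖g x y‖ ≤ M) (hMx : ∀ x y, ‖gx x y‖ ≤ M * weight (5 / 8) x)
    (hMy : ∀ x y, ‖gy x y‖ ≤ M * weight (5 / 8) y)
    (hMxy : ∀ x y, ‖gxy x y‖ ≤ M * (weight (5 / 8) x * weight (5 / 8) y)) (a b c d : ℝ) :
    ‖∫ y in c..d, ∫ x in a..b, g x y * e k x * e l y‖ ≤ oscConst k * (oscConst l * M) := by
  rw [integral_integral_mul_e_by_parts hk l hgx cg cgx, norm_mul, oscConst, mul_assoc]
  refine mul_le_mul_of_nonneg_left ?_ (norm_nonneg _)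
  have hbdry : ∀ x, ‖e k x * ∫ y in c..d, g x y * e l y‖ ≤ oscConst l * M := fun x => by
    rw [norm_mul, norm_e, one_mul]
    exact norm_integral_mul_e_le hl (hgy x) (by fun_prop) (hM x) (hMy x) c d
  have hmain : ‖∫ y in c..d, ∫ x in a..b, gx x y * e k x * e l y‖ ≤
      oscConst l * M * ∫ u, weight (5 / 8) u := by
    rw [intervalIntegral_swap_of_continuous (by fun_prop), ← integral_const_mul]
    refine norm_integral_le_integral_bound
      ((integrable_weight (by norm_num)).const_mul _) (fun x => ?_) a b
    have : ∀ y, gx x y * e k x * e l y = e k x * (gx x y * e l y) := fun y => by ring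
    simp_rw [this]
    rw [intervalIntegral.integral_const_mul, norm_mul, norm_e, one_mul, mul_assoc]
    refine norm_integral_mul_e_le hl (hgxy x) (by fun_prop) (hMx x) (fun y => ?_) c d
    rw [mul_assoc]
    exact hMxy x y
  have := hbdry a
  have := hbdry b
  calc _ ≤ ‖e k a * ∫ y in c..d, g a y * e l y‖ + ‖e k b * ∫ y in c..d, g b y * e l y‖ +
        ‖∫ y in c..d, ∫ x in a..b, gx x y * e k x * e l y‖ :=
        (norm_add_le _ _).trans (by gcongr; exact norm_sub_le _ _)
    _ ≤ oscConst l * M + oscConst l * M + oscConst l * M * ∫ u, weight (5 / 8) u := by gcongr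
    _ = (2 + ∫ u, weight (5 / 8) u) * (oscConst l * M) := by ring

lemma tendsto_of_tendsto_sub_mul_succ {ι : Type*} {l : Filter ι} {T : ℕ → ι → ℂ} {c L : ℂ}
    (h : ∀ m, Tendsto (fun i => T m i - c * T (m + 1) i) l (𝓝 0)) {n : ℕ}
    (hn : Tendsto (T n) l (𝓝 L)) : Tendsto (T 0) l (𝓝 (c ^ n * L)) := by
  have key : ∀ m, Tendsto (fun i => T 0 i - c ^ m * T m i) l (𝓝 0) := by
    intro m
    induction m with
    | zero => simpa using tendsto_const_nhds
    | succ m ih =>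
      have := ih.add ((h m).const_mul (c ^ m))
      rw [mul_zero, add_zero] at this
      refine this.congr fun i => ?_
      ring
  have := (key n).add (hn.const_mul (c ^ n))
  rw [zero_add] at this
  refine this.congr fun i => ?_
  ring

lemma tendsto_fst_atTop {α β : Type*} [Preorder α] [Preorder β] :
    Tendsto (Prod.fst : α × β → α) atTop atTop := by
  rw [← prod_atTop_atTop_eq]
  exact tendsto_fst

lemma tendsto_snd_atTop {α β : Type*} [Preorder α] [Preorder β] :
    Tendsto (Prod.snd : α × β → β) atTop atTop := by
  rw [← prod_atTop_atTop_eq]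
  exact tendsto_snd

lemma norm_mul_e (c : ℂ) (k x : ℝ) : ‖c * e k x‖ = ‖c‖ := by
  rw [norm_mul, norm_e, mul_one]

lemma integral_box_mul_e_by_parts {k : ℝ} (hk : k ≠ 0) (l m : ℝ) {g g' : ℝ → ℝ → ℝ → ℂ}
    (hg : ∀ x y z, HasDerivAt (fun t => g t y z) (g' x y z) x)
    (hgc : Continuous (fun p : ℝ × ℝ × ℝ => g p.1 p.2.1 p.2.2))
    (hg' : Continuous (fun p : ℝ × ℝ × ℝ => g' p.1 p.2.1 p.2.2)) (a b c d u v : ℝ) :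
    ∫ z in u..v, ∫ y in c..d, ∫ x in a..b, g x y z * e k x * e l y * e m z =
      (Complex.I * k)⁻¹ * (e k a * (∫ z in u..v, ∫ y in c..d, g a y z * e l y * e m z) -
        e k b * (∫ z in u..v, ∫ y in c..d, g b y z * e l y * e m z) +
        ∫ z in u..v, ∫ y in c..d, ∫ x in a..b, g' x y z * e k x * e l y * e m z) := by
  have hc : ∀ z, Continuous (Function.uncurry fun x y => g x y z) := fun z =>
    hgc.comp (by fun_prop : Continuous fun q : ℝ × ℝ => (q.1, q.2, z))
  have hc' : ∀ z, Continuous (Function.uncurry fun x y => g' x y z) := fun z =>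
    hg'.comp (by fun_prop : Continuous fun q : ℝ × ℝ => (q.1, q.2, z))
  have inner : ∀ z, ∫ y in c..d, ∫ x in a..b, g x y z * e k x * e l y * e m z =
      (Complex.I * k)⁻¹ * (e k a * (∫ y in c..d, g a y z * e l y * e m z) -
        e k b * (∫ y in c..d, g b y z * e l y * e m z) +
        ∫ y in c..d, ∫ x in a..b, g' x y z * e k x * e l y * e m z) := by
    intro z
    simp_rw [intervalIntegral.integral_mul_const (e m z)]
    rw [integral_integral_mul_e_by_parts hk l (fun x y => hg x y z) (hc z) (hc' z)]
    ring
  have c1 : ∀ t, Continuous fun z => e k t * ∫ y in c..d, g t y z * e l y * e m z := by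
    intro t
    refine continuous_const.mul
      (intervalIntegral.continuous_parametric_intervalIntegral_of_continuous' ?_ c d)
    have : Continuous fun q : ℝ × ℝ => g t q.2 q.1 :=
      hgc.comp (by fun_prop : Continuous fun q : ℝ × ℝ => (t, q.2, q.1))
    simp only [Function.uncurry_def]
    fun_prop
  have c2 : Continuous fun z =>
      ∫ y in c..d, ∫ x in a..b, g' x y z * e k x * e l y * e m z := by
    refine intervalIntegral.continuous_parametric_intervalIntegral_of_continuous' ?_ c d
    simp only [Function.uncurry_def]
    refine intervalIntegral.continuous_parametric_intervalIntegral_of_continuous' ?_ a b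
    have : Continuous fun q : (ℝ × ℝ) × ℝ => g' q.2 q.1.2 q.1.1 :=
      hg'.comp (by fun_prop : Continuous fun q : (ℝ × ℝ) × ℝ => (q.2, q.1.2, q.1.1))
    simp only [Function.uncurry_def]
    fun_prop
  simp_rw [inner]
  rw [intervalIntegral.integral_const_mul, intervalIntegral.integral_add
    (((c1 a).fun_sub (c1 b)).intervalIntegrable _ _) (c2.intervalIntegrable _ _),
    intervalIntegral.integral_sub ((c1 a).intervalIntegrable _ _) ((c1 b).intervalIntegrable _ _),
    intervalIntegral.integral_const_mul, intervalIntegral.integral_const_mul]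

/-- The transform in the first variable, written as an absolutely convergent integral. -/
def fstTransform (D : ℕ → ℕ → ℕ → ℝ → ℝ → ℝ → ℂ) (k y z : ℝ) : ℂ :=
  (Complex.I * (k : ℂ))⁻¹ ^ 5 * ∫ x, D 5 0 0 x y z * e k x

namespace DecayTower

variable {f : ℝ → ℝ → ℝ → ℝ} {D : ℕ → ℕ → ℕ → ℝ → ℝ → ℝ → ℂ}

lemma continuous_comp (h : DecayTower f D) {X : Type*} [TopologicalSpace X] (i j k : ℕ)
    {u v w : X → ℝ} (hu : Continuous u) (hv : Continuous v) (hw : Continuous w) :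
    Continuous fun p => D i j k (u p) (v p) (w p) :=
  (h.cont i j k).comp (hu.prodMk (hv.prodMk hw))

lemma norm_five_le (h : DecayTower f D) :
    ∃ K, 0 ≤ K ∧ ∀ x y z, ‖D 5 0 0 x y z‖ ≤ K * (weight 1 x * (weight 1 y * weight 1 z)) :=
  h.norm_le_weight 5 0 0 zero_le_one zero_le_one zero_le_one (by norm_num)

lemma exists_bound_boundary (h : DecayTower f D) (m : ℕ) :
    ∃ K, 0 ≤ K ∧ (∀ x y z, ‖D m 0 0 x y z‖ ≤ K * weight (1 / 4) x) ∧
      (∀ x y z, ‖D m 1 0 x y z‖ ≤ K * weight (1 / 4) x * weight (5 / 8) y) ∧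
      (∀ x y z, ‖D m 0 1 x y z‖ ≤ K * weight (1 / 4) x * weight (5 / 8) z) ∧
      (∀ x y z, ‖D m 1 1 x y z‖ ≤
        K * weight (1 / 4) x * (weight (5 / 8) y * weight (5 / 8) z)) := by
  have hm : (0 : ℝ) ≤ m := m.cast_nonneg
  obtain ⟨K₁, h₁, b₁⟩ := h.norm_le_weight m 0 0 (a := 1 / 4) (b := 0) (c := 0)
    (by norm_num) le_rfl le_rfl (by push_cast; linarith)
  obtain ⟨K₂, h₂, b₂⟩ := h.norm_le_weight m 1 0 (a := 1 / 4) (b := 5 / 8) (c := 0)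
    (by norm_num) (by norm_num) le_rfl (by push_cast; linarith)
  obtain ⟨K₃, h₃, b₃⟩ := h.norm_le_weight m 0 1 (a := 1 / 4) (b := 0) (c := 5 / 8)
    (by norm_num) le_rfl (by norm_num) (by push_cast; linarith)
  obtain ⟨K₄, h₄, b₄⟩ := h.norm_le_weight m 1 1 (a := 1 / 4) (b := 5 / 8) (c := 5 / 8)
    (by norm_num) (by norm_num) (by norm_num) (by push_cast; linarith)
  have w0 : ∀ u, weight 0 u = 1 := fun u => by simp [weight]
  simp only [w0, mul_one, one_mul] at b₁ b₂ b₃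
  refine ⟨K₁ + K₂ + K₃ + K₄, by positivity, fun x y z => (b₁ x y z).trans ?_,
    fun x y z => (b₂ x y z).trans ?_, fun x y z => (b₃ x y z).trans ?_,
    fun x y z => (b₄ x y z).trans ?_⟩
  all_goals
    have := weight_nonneg (1 / 4) x
    have := weight_nonneg (5 / 8) y
    have := weight_nonneg (5 / 8) z
    try simp only [mul_assoc]
    gcongr
    linarith

lemma tendsto_truncA (h : DecayTower f D) {k : ℝ} (hk : k ≠ 0) (y z : ℝ) :
    Tendsto (truncA f k y z) atTop (𝓝 (fstTransform D k y z)) := by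
  let T : ℕ → ℝ → ℂ := fun m r => ∫ x in -r..r, D m 0 0 x y z * e k x
  have hc : ∀ m, Continuous fun x => D m 0 0 x y z := fun m =>
    h.continuous_comp m 0 0 continuous_id continuous_const continuous_const
  have h0 : truncA f k y z = T 0 := by
    funext r
    simp only [truncA, T, h.zero]
  rw [h0]
  refine tendsto_of_tendsto_sub_mul_succ (c := (Complex.I * (k : ℂ))⁻¹) (fun m => ?_) ?_
  · obtain ⟨K, hK, hb, -⟩ := h.exists_bound_boundary m
    have hlim : Tendsto (fun r => ‖(Complex.I * (k : ℂ))⁻¹‖ *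
        (K * weight (1 / 4) r + K * weight (1 / 4) r)) atTop (𝓝 0) := by
      have := (tendsto_weight (a := 1 / 4) (by norm_num)).const_mul K
      simpa using (this.add this).const_mul ‖(Complex.I * (k : ℂ))⁻¹‖
    refine squeeze_zero_norm (fun r => ?_) hlim
    have : T m r - (Complex.I * (k : ℂ))⁻¹ * T (m + 1) r = (Complex.I * (k : ℂ))⁻¹ *
        (D m 0 0 (-r) y z * e k (-r) - D m 0 0 r y z * e k r) := by
      simp only [T]
      rw [integral_mul_e_by_parts hk (fun x => h.deriv_fst m 0 0 x y z) (hc (m + 1))]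
      ring
    rw [this, norm_mul]
    have h1 := hb (-r) y z
    have h2 := hb r y z
    rw [weight_neg] at h1
    refine mul_le_mul_of_nonneg_left ((norm_sub_le _ _).trans ?_) (norm_nonneg _)
    rw [norm_mul_e, norm_mul_e]
    exact add_le_add h1 h2
  · obtain ⟨K, hK, hb⟩ := h.norm_five_le
    have hcc := hc 5
    refine tendsto_integral_symm_interval
      (((integrable_weight (a := 1) (by norm_num)).mul_const (weight 1 y * weight 1 z)).const_mul K)
      (fun r => by fun_prop) (fun r x => ?_) tendsto_id (fun x => tendsto_const_nhds)
    rw [norm_mul_e]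
    exact hb x y z

lemma A_eq (h : DecayTower f D) {k : ℝ} (hk : k ≠ 0) (y z : ℝ) :
    A f k y z = fstTransform D k y z :=
  (h.tendsto_truncA hk y z).limUnder_eq

lemma stronglyMeasurable_fstTransform (h : DecayTower f D) (k : ℝ) :
    StronglyMeasurable fun p : ℝ × ℝ => fstTransform D k p.1 p.2 := by
  have hc : Continuous (Function.uncurry fun (p : ℝ × ℝ) x => D 5 0 0 x p.1 p.2 * e k x) := by
    have := h.continuous_comp (X := (ℝ × ℝ) × ℝ) 5 0 0 (u := fun q => q.2) (v := fun q => q.1.1)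
      (w := fun q => q.1.2) (by fun_prop) (by fun_prop) (by fun_prop)
    exact this.mul (by fun_prop)
  exact (hc.stronglyMeasurable.integral_prod_right).const_mul _

lemma norm_fstTransform_le (h : DecayTower f D) (k : ℝ) :
    ∃ K, 0 ≤ K ∧ ∀ y z, ‖fstTransform D k y z‖ ≤ K * (weight 1 y * weight 1 z) := by
  obtain ⟨K, hK, hb⟩ := h.norm_five_le
  refine ⟨‖(Complex.I * (k : ℂ))⁻¹ ^ 5‖ * (K * ∫ u, weight 1 u),
    mul_nonneg (norm_nonneg _) (mul_nonneg hK (integral_nonneg (weight_nonneg _))),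
    fun y z => ?_⟩
  rw [fstTransform, norm_mul, mul_assoc]
  refine mul_le_mul_of_nonneg_left ?_ (norm_nonneg _)
  have hi := ((integrable_weight (a := 1) (by norm_num)).mul_const
    (weight 1 y * weight 1 z)).const_mul K
  refine (norm_integral_le_of_norm_le hi (Eventually.of_forall fun x => ?_)).trans_eq ?_
  · rw [norm_mul_e]
    exact hb x y z
  · rw [integral_const_mul, integral_mul_const]
    ring

lemma integrable_fstTransform (h : DecayTower f D) (k₁ k₂ k₃ : ℝ) :
    Integrable fun p : ℝ × ℝ => fstTransform D k₁ p.1 p.2 * e k₂ p.1 * e k₃ p.2 := by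
  obtain ⟨K, hK, hb⟩ := h.norm_fstTransform_le k₁
  have hw := integrable_weight (a := 1) (by norm_num)
  refine ((hw.mul_prod hw).const_mul K).mono' ?_ (Eventually.of_forall fun p => ?_)
  · exact (((h.stronglyMeasurable_fstTransform k₁).mul
      ((by fun_prop : Continuous fun p : ℝ × ℝ => e k₂ p.1).stronglyMeasurable)).mul
      ((by fun_prop : Continuous fun p : ℝ × ℝ =>
        e k₃ p.2).stronglyMeasurable)).aestronglyMeasurable
  · rw [norm_mul_e, norm_mul_e]
    exact hb p.1 p.2

lemma integrable_fstTransform_fst (h : DecayTower f D) (k₁ k₂ k₃ z : ℝ) :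
    Integrable fun y => fstTransform D k₁ y z * e k₂ y * e k₃ z := by
  obtain ⟨K, hK, hb⟩ := h.norm_fstTransform_le k₁
  have hw := integrable_weight (a := 1) (by norm_num)
  refine ((hw.mul_const (weight 1 z)).const_mul K).mono' ?_ (Eventually.of_forall fun y => ?_)
  · exact ((((h.stronglyMeasurable_fstTransform k₁).comp_measurable
      (measurable_id.prodMk measurable_const)).mul
      (continuous_e k₂).stronglyMeasurable).mul_const _).aestronglyMeasurable
  · rw [norm_mul_e, norm_mul_e]
    exact hb y z

lemma tendsto_integral_integral_five (h : DecayTower f D) {ι : Type*} {l : Filter ι}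
    [l.IsCountablyGenerated] {r s : ι → ℝ} (hr : Tendsto r l atTop) (hs : Tendsto s l atTop)
    (k₁ k₂ z : ℝ) :
    Tendsto (fun p => ∫ y in -(s p)..s p, ∫ x in -(r p)..r p, D 5 0 0 x y z * e k₁ x * e k₂ y) l
      (𝓝 (∫ y, ∫ x, D 5 0 0 x y z * e k₁ x * e k₂ y)) := by
  obtain ⟨K, hK, hb⟩ := h.norm_five_le
  have hw := integrable_weight (a := 1) (by norm_num)
  have hx : ∀ y, Integrable fun x => K * (weight 1 x * (weight 1 y * weight 1 z)) := fun y =>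
    (hw.mul_const _).const_mul K
  have hbd : ∀ y x, ‖D 5 0 0 x y z * e k₁ x * e k₂ y‖ ≤
      K * (weight 1 x * (weight 1 y * weight 1 z)) := fun y x => by
    rw [norm_mul_e, norm_mul_e]
    exact hb x y z
  have hc : Continuous fun q : ℝ × ℝ => D 5 0 0 q.2 q.1 z :=
    h.continuous_comp 5 0 0 (by fun_prop) (by fun_prop) (by fun_prop)
  refine tendsto_integral_symm_interval
    (b := fun y => ∫ x, K * (weight 1 x * (weight 1 y * weight 1 z))) ?_ (fun p => ?_)
    (fun p y => norm_integral_le_integral_bound (hx y) (hbd y) _ _) hs (fun y => ?_)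
  · simp_rw [integral_const_mul, integral_mul_const]
    exact ((hw.mul_const _).const_mul _).const_mul K
  · refine intervalIntegral.continuous_parametric_intervalIntegral_of_continuous' ?_ _ _
    exact (hc.mul (by fun_prop)).mul (by fun_prop)
  · have hcx : Continuous fun x => D 5 0 0 x y z :=
      h.continuous_comp 5 0 0 continuous_id continuous_const continuous_const
    exact tendsto_integral_symm_interval (hx y) (fun p => by fun_prop) (fun p x => hbd y x) hr
      (fun x => tendsto_const_nhds)

lemma norm_integral_integral_five_le (h : DecayTower f D) (k₁ k₂ k₃ : ℝ) :
    ∃ K, ∀ z a b c d, ‖∫ y in c..d, ∫ x in a..b,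
      D 5 0 0 x y z * e k₁ x * e k₂ y * e k₃ z‖ ≤ K * weight 1 z := by
  obtain ⟨K, hK, hb⟩ := h.norm_five_le
  have hw := integrable_weight (a := 1) (by norm_num)
  refine ⟨K * (∫ u, weight 1 u) * ∫ u, weight 1 u, fun z a b c d => ?_⟩
  have inner : ∀ y, ‖∫ x in a..b, D 5 0 0 x y z * e k₁ x * e k₂ y * e k₃ z‖ ≤
      K * (∫ u, weight 1 u) * weight 1 z * weight 1 y := fun y => by
    refine (norm_integral_le_integral_bound
      ((hw.mul_const (weight 1 y * weight 1 z)).const_mul K) (fun x => ?_) a b).trans_eq ?_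
    · rw [norm_mul_e, norm_mul_e, norm_mul_e]
      exact hb x y z
    · rw [integral_const_mul, integral_mul_const]
      ring
  refine (norm_integral_le_integral_bound (hw.const_mul _) inner c d).trans_eq ?_
  rw [integral_const_mul]
  ring

lemma tendsto_truncF (h : DecayTower f D) {k₁ k₂ : ℝ} (hk₁ : k₁ ≠ 0) (hk₂ : k₂ ≠ 0) (z : ℝ) :
    Tendsto (truncF f k₁ k₂ z) atTop (𝓝 (∫ y, fstTransform D k₁ y z * e k₂ y)) := by
  let T : ℕ → ℝ × ℝ → ℂ := fun m p =>
    ∫ y in -p.2..p.2, ∫ x in -p.1..p.1, D m 0 0 x y z * e k₁ x * e k₂ y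
  have hc : ∀ m, Continuous (Function.uncurry fun x y => D m 0 0 x y z) := fun m =>
    h.continuous_comp m 0 0 continuous_fst continuous_snd continuous_const
  have hfst := tendsto_fst_atTop (α := ℝ) (β := ℝ)
  have hsnd := tendsto_snd_atTop (α := ℝ) (β := ℝ)
  have h0 : truncF f k₁ k₂ z = T 0 := by
    funext r
    simp only [truncF, T, h.zero]
  have hL : ∫ y, fstTransform D k₁ y z * e k₂ y = (Complex.I * (k₁ : ℂ))⁻¹ ^ 5 *
      ∫ y, ∫ x, D 5 0 0 x y z * e k₁ x * e k₂ y := by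
    simp_rw [fstTransform, integral_mul_const]
    rw [← integral_const_mul]
    simp_rw [mul_assoc]
  rw [h0, hL]
  refine tendsto_of_tendsto_sub_mul_succ (fun m => ?_)
    (h.tendsto_integral_integral_five hfst hsnd k₁ k₂ z)
  obtain ⟨K, hK, hb, hby, -⟩ := h.exists_bound_boundary m
  have hlim : Tendsto (fun p : ℝ × ℝ => ‖(Complex.I * (k₁ : ℂ))⁻¹‖ *
      (oscConst k₂ * (K * weight (1 / 4) p.1) + oscConst k₂ * (K * weight (1 / 4) p.1)))
      atTop (𝓝 0) := by
    have := ((((tendsto_weight (a := 1 / 4) (by norm_num)).comp hfst).const_mul K).const_mul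
      (oscConst k₂))
    simpa using (this.add this).const_mul ‖(Complex.I * (k₁ : ℂ))⁻¹‖
  refine squeeze_zero_norm (fun p => ?_) hlim
  have hstep : T m p - (Complex.I * (k₁ : ℂ))⁻¹ * T (m + 1) p = (Complex.I * (k₁ : ℂ))⁻¹ *
      (e k₁ (-p.1) * (∫ y in -p.2..p.2, D m 0 0 (-p.1) y z * e k₂ y) -
        e k₁ p.1 * (∫ y in -p.2..p.2, D m 0 0 p.1 y z * e k₂ y)) := by
    simp only [T]
    rw [integral_integral_mul_e_by_parts hk₁ k₂ (fun x y => h.deriv_fst m 0 0 x y z) (hc m)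
      (hc (m + 1))]
    ring
  have hbdry : ∀ x, ‖e k₁ x * ∫ y in -p.2..p.2, D m 0 0 x y z * e k₂ y‖ ≤
      oscConst k₂ * (K * weight (1 / 4) x) := fun x => by
    rw [norm_mul, norm_e, one_mul]
    exact norm_integral_mul_e_le hk₂ (fun y => h.deriv_snd m 0 0 x y z)
      (h.continuous_comp m 1 0 continuous_const continuous_id continuous_const)
      (fun y => hb x y z) (fun y => hby x y z) _ _
  have h1 := hbdry (-p.1)
  rw [weight_neg] at h1
  rw [hstep, norm_mul]
  exact mul_le_mul_of_nonneg_left ((norm_sub_le _ _).trans (add_le_add h1 (hbdry p.1)))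
    (norm_nonneg _)

lemma F_eq (h : DecayTower f D) {k₁ k₂ : ℝ} (hk₁ : k₁ ≠ 0) (hk₂ : k₂ ≠ 0) (z : ℝ) :
    F f k₁ k₂ z = ∫ y, fstTransform D k₁ y z * e k₂ y :=
  (h.tendsto_truncF hk₁ hk₂ z).limUnder_eq

lemma tendsto_truncBox (h : DecayTower f D) {k₁ k₂ k₃ : ℝ} (hk₁ : k₁ ≠ 0) (hk₂ : k₂ ≠ 0)
    (hk₃ : k₃ ≠ 0) :
    Tendsto (truncBox f k₁ k₂ k₃) atTop
      (𝓝 (∫ z, ∫ y, fstTransform D k₁ y z * e k₂ y * e k₃ z)) := by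
  let T : ℕ → ℝ × ℝ × ℝ → ℂ := fun m p =>
    ∫ z in -p.2.2..p.2.2, ∫ y in -p.2.1..p.2.1, ∫ x in -p.1..p.1,
      D m 0 0 x y z * e k₁ x * e k₂ y * e k₃ z
  have hfst := tendsto_fst_atTop (α := ℝ) (β := ℝ × ℝ)
  have hsnd := (tendsto_fst_atTop (α := ℝ) (β := ℝ)).comp (tendsto_snd_atTop (α := ℝ))
  have hthd := (tendsto_snd_atTop (α := ℝ) (β := ℝ)).comp (tendsto_snd_atTop (α := ℝ))
  have h0 : truncBox f k₁ k₂ k₃ = T 0 := by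
    funext r
    simp only [truncBox, T, h.zero]
  have hL : ∫ z, ∫ y, fstTransform D k₁ y z * e k₂ y * e k₃ z = (Complex.I * (k₁ : ℂ))⁻¹ ^ 5 *
      ∫ z, (∫ y, ∫ x, D 5 0 0 x y z * e k₁ x * e k₂ y) * e k₃ z := by
    simp_rw [fstTransform, integral_mul_const, mul_assoc, integral_const_mul]
    rw [← integral_const_mul]
    simp_rw [mul_assoc]
  rw [h0, hL]
  refine tendsto_of_tendsto_sub_mul_succ (n := 5) (fun m => ?_) ?_
  · obtain ⟨K, hK, hb, hby, hbz, hbyz⟩ := h.exists_bound_boundary m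
    have hlim : Tendsto (fun p : ℝ × ℝ × ℝ => ‖(Complex.I * (k₁ : ℂ))⁻¹‖ *
        (oscConst k₂ * (oscConst k₃ * (K * weight (1 / 4) p.1)) +
          oscConst k₂ * (oscConst k₃ * (K * weight (1 / 4) p.1)))) atTop (𝓝 0) := by
      have := ((((tendsto_weight (a := 1 / 4) (by norm_num)).comp hfst).const_mul K).const_mul
        (oscConst k₃)).const_mul (oscConst k₂)
      simpa using (this.add this).const_mul ‖(Complex.I * (k₁ : ℂ))⁻¹‖
    refine squeeze_zero_norm (fun p => ?_) hlim
    have hstep : T m p - (Complex.I * (k₁ : ℂ))⁻¹ * T (m + 1) p = (Complex.I * (k₁ : ℂ))⁻¹ *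
        (e k₁ (-p.1) * (∫ z in -p.2.2..p.2.2, ∫ y in -p.2.1..p.2.1,
            D m 0 0 (-p.1) y z * e k₂ y * e k₃ z) -
          e k₁ p.1 * (∫ z in -p.2.2..p.2.2, ∫ y in -p.2.1..p.2.1,
            D m 0 0 p.1 y z * e k₂ y * e k₃ z)) := by
      simp only [T]
      rw [integral_box_mul_e_by_parts hk₁ k₂ k₃ (h.deriv_fst m 0 0) (h.cont m 0 0)
        (h.cont (m + 1) 0 0)]
      ring
    have hc : ∀ x j k, Continuous (Function.uncurry fun y z => D m j k x y z) := fun x j k =>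
      h.continuous_comp m j k continuous_const continuous_fst continuous_snd
    have hbdry : ∀ x, ‖e k₁ x * ∫ z in -p.2.2..p.2.2, ∫ y in -p.2.1..p.2.1,
        D m 0 0 x y z * e k₂ y * e k₃ z‖ ≤
        oscConst k₂ * (oscConst k₃ * (K * weight (1 / 4) x)) := fun x => by
      rw [norm_mul, norm_e, one_mul]
      exact norm_integral_integral_mul_e_le hk₂ hk₃ (h.deriv_snd m 0 0 x) (h.deriv_thd m 0 0 x)
        (h.deriv_thd m 1 0 x) (hc x 0 0) (hc x 1 0) (hc x 0 1) (hc x 1 1) (hb x) (hby x) (hbz x)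
        (hbyz x) _ _ _ _
    have h1 := hbdry (-p.1)
    rw [weight_neg] at h1
    rw [hstep, norm_mul]
    exact mul_le_mul_of_nonneg_left ((norm_sub_le _ _).trans (add_le_add h1 (hbdry p.1)))
      (norm_nonneg _)
  · obtain ⟨K, hb⟩ := h.norm_integral_integral_five_le k₁ k₂ k₃
    refine tendsto_integral_symm_interval
      ((integrable_weight (a := 1) (by norm_num)).const_mul K) (fun p => ?_)
      (fun p z => hb z _ _ _ _) hthd (fun z => ?_)
    · refine intervalIntegral.continuous_parametric_intervalIntegral_of_continuous' ?_ _ _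
      simp only [Function.uncurry_def]
      refine intervalIntegral.continuous_parametric_intervalIntegral_of_continuous' ?_ _ _
      have : Continuous fun q : (ℝ × ℝ) × ℝ => D 5 0 0 q.2 q.1.2 q.1.1 :=
        h.continuous_comp 5 0 0 (by fun_prop) (by fun_prop) (by fun_prop)
      exact ((this.mul (by fun_prop)).mul (by fun_prop)).mul (by fun_prop)
    · simp_rw [intervalIntegral.integral_mul_const (e k₃ z)]
      exact (h.tendsto_integral_integral_five hfst hsnd k₁ k₂ z).mul_const _

end DecayTower

lemma integral_integral_mul_e_eq_snd (a : ℝ → ℝ → ℂ) (k l : ℝ) :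
    ∫ z, ∫ y, a y z * e k y * e l z = ∫ z, (∫ y, a y z * e k y) * e l z := by
  simp_rw [integral_mul_const]

lemma integral_integral_mul_e_eq_fst {a : ℝ → ℝ → ℂ} {k l : ℝ}
    (h : Integrable fun p : ℝ × ℝ => a p.1 p.2 * e k p.1 * e l p.2) :
    ∫ z, ∫ y, a y z * e k y * e l z = ∫ y, (∫ z, a y z * e l z) * e k y := by
  rw [← integral_integral_swap h]
  refine congrArg _ (funext fun y => ?_)
  rw [← integral_mul_const]
  exact congrArg _ (funext fun z => mul_right_comm _ _ _)

lemma integrable_integral_mul_e {a : ℝ → ℝ → ℂ} {k l : ℝ}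
    (h : Integrable fun p : ℝ × ℝ => a p.1 p.2 * e k p.1 * e l p.2) :
    Integrable fun z => (∫ y, a y z * e k y) * e l z := by
  simpa only [integral_mul_const] using h.integral_prod_right

namespace DecayTower

variable {f : ℝ → ℝ → ℝ → ℝ} {D : ℕ → ℕ → ℕ → ℝ → ℝ → ℝ → ℂ}

/-- The double transform in the first two variables does not depend on the order of
integration. -/
lemma integral_fstTransform_swap (h : DecayTower f D) {k₁ k₂ : ℝ} (hk₁ : k₁ ≠ 0) (hk₂ : k₂ ≠ 0)
    (z : ℝ) :
    ∫ y, fstTransform D k₁ y z * e k₂ y =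
      ∫ x, fstTransform (fun j i k y x z => D i j k x y z) k₂ x z * e k₁ x := by
  have hswap : Tendsto (fun p : ℝ × ℝ => (p.2, p.1)) atTop atTop := by
    have := (tendsto_snd_atTop (α := ℝ) (β := ℝ)).prodMk (tendsto_fst_atTop (α := ℝ) (β := ℝ))
    rwa [prod_atTop_atTop_eq] at this
  refine tendsto_nhds_unique (h.tendsto_truncF hk₁ hk₂ z)
    (((h.swap_fst.tendsto_truncF hk₂ hk₁ z).comp hswap).congr fun p => ?_)
  have hc : Continuous fun q : ℝ × ℝ => (f q.1 q.2 z : ℂ) := by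
    simpa only [h.zero] using
      h.continuous_comp 0 0 0 continuous_fst continuous_snd (continuous_const (y := z))
  simp only [Function.comp, truncF]
  rw [intervalIntegral_swap_of_continuous]
  · simp_rw [mul_right_comm]
  · exact (hc.mul (by fun_prop)).mul (by fun_prop)

end DecayTower

end

end NormalFourier

open NormalFourier in
theorem lemma5p3 (f : ℝ → ℝ → ℝ → ℝ) (hf : NormalFourier.Normal₃ f)
    (k₁ k₂ k₃ : ℝ) (hk₁ : k₁ ≠ 0) (hk₂ : k₂ ≠ 0) (hk₃ : k₃ ≠ 0) :
    NormalFourier.PartialTransformsExist f k₁ k₂ k₃ ∧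
    NormalFourier.FullTransformsDefined f k₁ k₂ k₃ ∧
    NormalFourier.hatA f k₁ k₂ k₃ = NormalFourier.hatB f k₁ k₂ k₃ ∧
    NormalFourier.hatB f k₁ k₂ k₃ = NormalFourier.hatC f k₁ k₂ k₃ ∧
    NormalFourier.hatC f k₁ k₂ k₃ = NormalFourier.hatF f k₁ k₂ k₃ ∧
    NormalFourier.hatF f k₁ k₂ k₃ = NormalFourier.hatG f k₁ k₂ k₃ ∧
    NormalFourier.hatG f k₁ k₂ k₃ = NormalFourier.hatH f k₁ k₂ k₃ ∧
    Tendsto (NormalFourier.truncBox f k₁ k₂ k₃) atTop (𝓝 (NormalFourier.hatA f k₁ k₂ k₃)) := by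
  obtain ⟨D, h⟩ := hf.exists_decayTower
  let a : ℝ → ℝ → ℂ := fun y z => fstTransform D k₁ y z
  let b : ℝ → ℝ → ℂ := fun x z => fstTransform (fun j i k y x z => D i j k x y z) k₂ x z
  let c : ℝ → ℝ → ℂ := fun x y => fstTransform (fun k i j z x y => D i j k x y z) k₃ x y
  have hxzy := h.swap_snd
  have hyxz := h.swap_fst
  have hzxy := h.swap_snd.swap_fst
  have hyzx := h.swap_fst.swap_snd
  have hA : ∀ y z, A f k₁ y z = a y z := h.A_eq hk₁
  have hB : ∀ x z, B f x k₂ z = b x z := hyxz.A_eq hk₂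
  have hC : ∀ x y, C f x y k₃ = c x y := hzxy.A_eq hk₃
  have hFa : ∀ z, F f k₁ k₂ z = ∫ y, a y z * e k₂ y := h.F_eq hk₁ hk₂
  have hFb : ∀ z, F f k₁ k₂ z = ∫ x, b x z * e k₁ x := fun z =>
    (hFa z).trans (h.integral_fstTransform_swap hk₁ hk₂ z)
  have hGa : ∀ y, G f k₁ y k₃ = ∫ z, a y z * e k₃ z := hxzy.F_eq hk₁ hk₃
  have hGc : ∀ y, G f k₁ y k₃ = ∫ x, c x y * e k₁ x := fun y =>
    (hGa y).trans (hxzy.integral_fstTransform_swap hk₁ hk₃ y)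
  have hHb : ∀ x, H f x k₂ k₃ = ∫ z, b x z * e k₃ z := hyzx.F_eq hk₂ hk₃
  have hHc : ∀ x, H f x k₂ k₃ = ∫ y, c x y * e k₂ y := fun x =>
    (hHb x).trans (hyzx.integral_fstTransform_swap hk₂ hk₃ x)
  have ia : Integrable fun p : ℝ × ℝ => a p.1 p.2 * e k₂ p.1 * e k₃ p.2 :=
    h.integrable_fstTransform k₁ k₂ k₃
  have ib : Integrable fun p : ℝ × ℝ => b p.1 p.2 * e k₁ p.1 * e k₃ p.2 :=
    hyxz.integrable_fstTransform k₂ k₁ k₃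
  have ic : Integrable fun p : ℝ × ℝ => c p.1 p.2 * e k₁ p.1 * e k₂ p.2 :=
    hzxy.integrable_fstTransform k₃ k₁ k₂
  have ic' : Integrable fun p : ℝ × ℝ => c p.2 p.1 * e k₂ p.1 * e k₁ p.2 :=
    hzxy.swap_snd.integrable_fstTransform k₃ k₂ k₁
  have ja : ∀ z, Integrable fun y => a y z * e k₂ y * e k₃ z :=
    h.integrable_fstTransform_fst k₁ k₂ k₃
  have jb : ∀ z, Integrable fun x => b x z * e k₁ x * e k₃ z :=
    hyxz.integrable_fstTransform_fst k₂ k₁ k₃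
  have jc : ∀ y, Integrable fun x => c x y * e k₁ x * e k₂ y :=
    hzxy.integrable_fstTransform_fst k₃ k₁ k₂
  have hatA_eq_F : hatA f k₁ k₂ k₃ = hatF f k₁ k₂ k₃ := by
    simp only [hatA, hatF, hA, hFa]
    exact integral_integral_mul_e_eq_snd _ _ _
  have hatB_eq_F : hatB f k₁ k₂ k₃ = hatF f k₁ k₂ k₃ := by
    simp only [hatB, hatF, hB, hFb]
    exact integral_integral_mul_e_eq_snd _ _ _
  have hatA_eq_G : hatA f k₁ k₂ k₃ = hatG f k₁ k₂ k₃ := by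
    simp only [hatA, hatG, hA, hGa]
    exact integral_integral_mul_e_eq_fst ia
  have hatC_eq_G : hatC f k₁ k₂ k₃ = hatG f k₁ k₂ k₃ := by
    simp only [hatC, hatG, hC, hGc]
    exact integral_integral_mul_e_eq_snd _ _ _
  have hatC_eq_H : hatC f k₁ k₂ k₃ = hatH f k₁ k₂ k₃ := by
    simp only [hatC, hatH, hC, hHc]
    exact integral_integral_mul_e_eq_fst ic
  refine ⟨⟨fun y z => ?_, fun x z => ?_, fun x y => ?_, fun z => ?_, fun y => ?_, fun x => ?_⟩,
    ⟨?_, fun z => ?_, ?_, fun z => ?_, ?_, fun y => ?_, ?_, ?_, ?_⟩,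
    hatA_eq_F.trans hatB_eq_F.symm,
    hatB_eq_F.trans (hatA_eq_F.symm.trans (hatA_eq_G.trans hatC_eq_G.symm)),
    hatC_eq_G.trans (hatA_eq_G.symm.trans hatA_eq_F), hatA_eq_F.symm.trans hatA_eq_G,
    hatC_eq_G.symm.trans hatC_eq_H, ?_⟩
  · rw [hA]
    exact h.tendsto_truncA hk₁ y z
  · rw [hB]
    exact hyxz.tendsto_truncA hk₂ x z
  · rw [hC]
    exact hzxy.tendsto_truncA hk₃ x y
  · rw [hFa]
    exact h.tendsto_truncF hk₁ hk₂ z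
  · rw [hGa]
    exact hxzy.tendsto_truncF hk₁ hk₃ y
  · rw [hHb]
    exact hyzx.tendsto_truncF hk₂ hk₃ x
  · simpa only [hA] using ia
  · simpa only [hA] using ja z
  · simpa only [hB] using ib
  · simpa only [hB] using jb z
  · simpa only [hC] using ic
  · simpa only [hC] using jc y
  · simpa only [hFa] using integrable_integral_mul_e (a := a) ia
  · simpa only [hGc] using integrable_integral_mul_e (a := c) ic
  · simpa only [hHc] using integrable_integral_mul_e (a := fun y x => c x y) ic'
  · simp only [hatA, hA]
    exact h.tendsto_truncBox hk₁ hk₂ hk₃
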